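/- Let $(R,\mathfrak m)$ be a noetherian local ring, let $\mathfrak a\subseteq R$ be an ideal such that $R$ is $\mathfrak a$-adically complete, and put $S=R/\mathfrak a$. Let $\mathfrak b\subseteq R$ be an ideal with $\sqrt{\mathfrak a+\mathfrak b}=\mathfrak m$. Let $s$ be the Artin--Rees number of $\mathfrak b$ with respect to $\mathfrak a$, i.e. the least integer $s\ge 0$ such that $\mathfrak b\cap\mathfrak a^{n}=\mathfrak a^{n-s}(\mathfrak b\cap\mathfrak a^{s})$ for all $n\ge s$, and assume that $$\mathfrak b\cap\mathfrak a^n\subseteq\mathfrak m\mathfrak a^n$$ for some $n\ge s$ (equivalently, for all sufficiently large $n$). Put $I_n=\mathfrak b+\mathfrak a^n$ for $n\ge 1$. Then: 1. $\{R/I_n\}_{n\ge1}$ is a lifting system for the $S$-module $S/\mathfrak bS$ along $R\twoheadrightarrow S$. Here a family $\{M_n\}_{n\ge1}$ of $R$-modules of finite length is a lifting system for an $S$-module $M$ of finite length if $M_1\cong M$ and, for all $n\ge1$, $\mathfrak a^n\subseteq\operatorname{ann}_RM_n$ and $M_{n+1}/\mathfrak a^nM_{n+1}\cong M_n$. 2.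 There is an integer $d\ge\ell(\mathfrak a)$ such that the lengths satisfy $\ell_R(R/I_n)\approx n^d$, that is, there are real polynomials $f,g$ of degree $d$ with positive leading coefficients such that $f(n)\le\ell_R(R/I_n)\le g(n)$ for all $n\gg0$. Here $\ell(\mathfrak a)$ is the analytic spread of $\mathfrak a$, the Krull dimension of the fiber ring $\bigoplus_{n\ge0}\mathfrak a^n/\mathfrak m\mathfrak a^n$. 3. In particular, $\dim R/\mathfrak b\ge\ell(\mathfrak a)$. -/

import Mathlib

open IsLocalRing Filter

universe u v w

/-- A family `M 1, M 2, …` of `R`-modules (the value `M 0` plays no role) is a lifting system for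
the finite length `R ⧸ a`-module `M₀` along the surjection `R → R ⧸ a`: every `M n` has finite
length over `R`, `M 1` is `M₀`, the ideal `a ^ n` annihilates `M n`, and
`M (n + 1) / a ^ n M (n + 1) ≅ M n`. -/
structure IsLiftingSystem {R : Type u} [CommRing R] (a : Ideal R)
    (M₀ : Type v) [AddCommGroup M₀] [Module R M₀] [Module (R ⧸ a) M₀] [IsScalarTower R (R ⧸ a) M₀]
    (M : ℕ → Type w) [∀ n, AddCommGroup (M n)] [∀ n, Module R (M n)] : Prop where
  finiteLength_base : IsFiniteLength (R ⧸ a) M₀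
  finiteLength : ∀ n, 1 ≤ n → IsFiniteLength R (M n)
  one : Nonempty (M 1 ≃ₗ[R] M₀)
  pow_le_annihilator : ∀ n, 1 ≤ n → a ^ n ≤ Module.annihilator R (M n)
  succ : ∀ n, 1 ≤ n →
    Nonempty ((M (n + 1) ⧸ (a ^ n • (⊤ : Submodule R (M (n + 1))))) ≃ₗ[R] M n)

/-- `u n ≈ n ^ d`: for large `n` the value `u n` is finite and lies between the values at `n` of two
real polynomials of degree `d` with positive leading coefficients. -/
def GrowsLikePow (u : ℕ → ℕ∞) (d : ℕ) : Prop :=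
  ∃ f g : Polynomial ℝ,
    f.natDegree = d ∧ 0 < f.leadingCoeff ∧ g.natDegree = d ∧ 0 < g.leadingCoeff ∧
      ∀ᶠ n : ℕ in atTop, ∃ k : ℕ, u n = k ∧ f.eval (n : ℝ) ≤ k ∧ (k : ℝ) ≤ g.eval (n : ℝ)

/-- The fiber ring `⨁ n, a ^ n / m a ^ n` of an ideal `a` of a local ring with maximal ideal `m`:
the Rees algebra of `a` modulo the ideal generated by `m`. -/
abbrev FiberRing {R : Type u} [CommRing R] [IsLocalRing R] (a : Ideal R) : Type u :=
  reesAlgebra a ⧸ (maximalIdeal R).map (algebraMap R (reesAlgebra a))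

/-- The analytic spread of `a`: the Krull dimension of the fiber ring. -/
noncomputable def analyticSpread {R : Type u} [CommRing R] [IsLocalRing R] (a : Ideal R) :
    WithBot ℕ∞ :=
  ringKrullDim (FiberRing a)

/-- The Artin–Rees number of `b` with respect to `a`: the least `s` such that
`b ∩ a ^ n = a ^ (n - s) (b ∩ a ^ s)` for all `n ≥ s`. -/
noncomputable def artinReesNumber {R : Type u} [CommRing R] (a b : Ideal R) : ℕ :=
  sInf {s : ℕ | ∀ n, s ≤ n → b ⊓ a ^ n = a ^ (n - s) * (b ⊓ a ^ s)}

/-! The length of `R ⧸ (b ⊔ a ^ n)` is compared with μ(0) + ... + μ(n - 1), where μ(i) is the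
minimal number of generators of `a ^ i`. The increment from n to n + 1 is the length of the image of
`a ^ n` in `R ⧸ (b ⊔ a ^ (n + 1))`. It is at most μ(n) times the length of `R ⧸ (a ⊔ b)`, because
`(a ⊔ b) * a ^ n` dies in that image. For large n it is at least μ(n): the Artin–Rees property
carries `b ⊓ a ^ n ≤ m a ^ n` to all larger exponents, so the kernel lies in `m a ^ n` and Nakayama
applies (`spanFinrank_le_length_pow_quotient_comap`).

The sum of the μ(i) is the dimension of the part of degree at most n - 1 of the fiber ring. By
Noether normalization the fiber ring is finite over a polynomial ring in r variables contained in
it, so these dimensions lie between constant multiples of n ^ r, and integrality gives ℓ(a) ≤ r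
(`IsStandardFiltration.exists_growth`). This r is the exponent d.

For the dimension bound, choose at most dim R/b parameters of `R ⧸ b`. High powers of them lie in `b
⊔ a ^ n`, so the lengths are O(n ^ δ) with δ ≤ dim R/b (`exists_length_quotient_sup_pow_le`).
Comparing exponents gives r ≤ δ. -/

theorem ringKrullDim_le_of_isIntegral (A B : Type*) [CommRing A] [CommRing B] [Algebra A B]
    [Algebra.IsIntegral A B] : ringKrullDim B ≤ ringKrullDim A :=
  Order.krullDim_le_of_strictMono (PrimeSpectrum.comap (algebraMap A B))
    fun _ _ h => Ideal.IsIntegral.comap_lt_comap h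

theorem Submodule.FG.exists_le_of_monotone {A M : Type*} [Semiring A] [AddCommMonoid M] [Module A M]
    {N : Submodule A M} (hN : N.FG) {B : ℕ → Submodule A M} (hB : Monotone B)
    (h : ∀ x, ∃ n, x ∈ B n) : ∃ n, N ≤ B n := by
  obtain ⟨s, rfl⟩ := hN
  choose c hc using h
  refine ⟨s.sup c, Submodule.span_le.2 fun x hx => hB (Finset.le_sup hx) (hc x)⟩

/-! ### Polynomials of bounded degree in each variable -/

namespace MvPolynomial

theorem restrictDegree_mono (σ A : Type*) [CommSemiring A] : Monotone (restrictDegree σ A) :=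
  fun _ _ h => restrictSupport_mono A fun _ hs i => (hs i).trans h

theorem mem_restrictDegree_totalDegree {σ A : Type*} [CommSemiring A] (p : MvPolynomial σ A) :
    p ∈ restrictDegree σ A p.totalDegree :=
  restrictTotalDegree_le_restrictDegree _ A _ ((mem_restrictTotalDegree _ _ _).2 le_rfl)

theorem mul_mem_restrictDegree {σ A : Type*} [CommSemiring A] {p q : MvPolynomial σ A} {m n : ℕ}
    (hp : p ∈ restrictDegree σ A m) (hq : q ∈ restrictDegree σ A n) :
    p * q ∈ restrictDegree σ A (m + n) := by
  classical
  rw [mem_restrictDegree] at *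
  intro s hs i
  obtain ⟨u, hu, v, hv, rfl⟩ := Finset.mem_add.1 (support_mul p q hs)
  exact add_le_add (hp u hu i) (hq v hv i)

/-- Bounding each variable separately, rather than the total degree, makes the exponents of the
monomial basis a cube, so the count is an exact power. -/
theorem finrank_restrictDegree (σ k : Type*) [Fintype σ] [Field k] (m : ℕ) :
    Module.finrank k (restrictDegree σ k m) = (m + 1) ^ Fintype.card σ := by
  classical
  let e : {s : σ →₀ ℕ | ∀ i, s i ≤ m} ≃ (σ → Fin (m + 1)) :=
    { toFun := fun s i => ⟨s.1 i, Nat.lt_succ_of_le (s.2 i)⟩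
      invFun := fun f => ⟨Finsupp.equivFunOnFinite.symm fun i => f i,
        fun i => Nat.le_of_lt_succ (f i).2⟩
      left_inv := fun s => by ext; rfl
      right_inv := fun f => by ext; rfl }
  have := Module.finrank_eq_card_basis
    ((basisRestrictSupport k {s : σ →₀ ℕ | ∀ i, s i ≤ m}).reindex e)
  rw [Fintype.card_fun, Fintype.card_fin] at this
  exact this

end MvPolynomial

open MvPolynomial

/-! ### Growth of filtered algebras via Noether normalization -/

section Growth

variable {k F : Type*} [Field k] [CommRing F] [Algebra k F]

/-- Elements of the form `∑ l, g (p l) * e l` whose coefficients have degree at most `c` in each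
variable. -/
noncomputable def boundedCombinations {r E : ℕ} (g : MvPolynomial (Fin r) k →ₐ[k] F)
    (e : Fin E → F) (c : ℕ) : Submodule k F :=
  LinearMap.range (∑ l, LinearMap.mulRight k (e l) ∘ₗ g.toLinearMap ∘ₗ
    (restrictDegree (Fin r) k c).subtype ∘ₗ LinearMap.proj l)

theorem mem_boundedCombinations {r E : ℕ} {g : MvPolynomial (Fin r) k →ₐ[k] F} {e : Fin E → F}
    {c : ℕ} {x : F} : x ∈ boundedCombinations g e c ↔
      ∃ p : Fin E → restrictDegree (Fin r) k c, ∑ l, g (p l) * e l = x := by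
  simp [boundedCombinations, LinearMap.mem_range]

theorem finrank_boundedCombinations_le {r E : ℕ} (g : MvPolynomial (Fin r) k →ₐ[k] F)
    (e : Fin E → F) (c : ℕ) :
    Module.finrank k (boundedCombinations g e c) ≤ E * (c + 1) ^ r := by
  refine (LinearMap.finrank_range_le _).trans ?_
  rw [Module.finrank_pi_fintype]
  simp [finrank_restrictDegree]

theorem mul_mem_boundedCombinations {r E : ℕ} {g : MvPolynomial (Fin r) k →ₐ[k] F} {e : Fin E → F}
    {c d : ℕ} {q : MvPolynomial (Fin r) k} (hq : q ∈ restrictDegree (Fin r) k d) {x : F}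
    (hx : x ∈ boundedCombinations g e c) : g q * x ∈ boundedCombinations g e (d + c) := by
  obtain ⟨p, rfl⟩ := mem_boundedCombinations.1 hx
  refine mem_boundedCombinations.2 ⟨fun l => ⟨q * p l, mul_mem_restrictDegree hq (p l).2⟩, ?_⟩
  simp [Finset.mul_sum, mul_assoc]

theorem boundedCombinations_mono {r E : ℕ} (g : MvPolynomial (Fin r) k →ₐ[k] F) (e : Fin E → F) :
    Monotone (boundedCombinations g e) := by
  intro c d h x hx
  obtain ⟨p, rfl⟩ := mem_boundedCombinations.1 hx
  exact mem_boundedCombinations.2 ⟨fun l => ⟨p l, restrictDegree_mono _ _ h (p l).2⟩, rfl⟩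

instance {r E : ℕ} (g : MvPolynomial (Fin r) k →ₐ[k] F) (e : Fin E → F) (c : ℕ) :
    Module.Finite k (boundedCombinations g e c) := by
  unfold boundedCombinations; infer_instance

/-- An exhaustive multiplicative filtration of an algebra by finite dimensional subspaces, generated
in degree one. -/
structure IsStandardFiltration {k F : Type*} [CommRing k] [CommRing F] [Algebra k F]
    (W : ℕ → Submodule k F) : Prop where
  mono : Monotone W
  one_mem : (1 : F) ∈ W 0
  mul_le : ∀ i j, W i * W j ≤ W (i + j)
  succ_le : ∀ n, W (n + 1) ≤ W 1 * W n
  exhaustive : ∀ x, ∃ n, x ∈ W n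
  fg : ∀ n, (W n).FG

variable {W : ℕ → Submodule k F}

theorem IsStandardFiltration.pow_mem (hW : IsStandardFiltration W) {i : ℕ} {x : F} (hx : x ∈ W i)
    (n : ℕ) : x ^ n ∈ W (n * i) := by
  induction n with
  | zero => simpa using hW.one_mem
  | succ n ih =>
    rw [pow_succ, Nat.succ_mul]
    exact hW.mul_le _ _ (Submodule.mul_mem_mul ih hx)

theorem IsStandardFiltration.prod_mem (hW : IsStandardFiltration W) {ι : Type*} (s : Finset ι)
    (x : ι → F) (d : ι → ℕ) (hx : ∀ i ∈ s, x i ∈ W (d i)) : ∏ i ∈ s, x i ∈ W (∑ i ∈ s, d i) := by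
  classical
  induction s using Finset.induction_on with
  | empty => simpa using hW.one_mem
  | insert i s hi ih =>
    rw [Finset.prod_insert hi, Finset.sum_insert hi]
    exact hW.mul_le _ _ (Submodule.mul_mem_mul (hx i (by simp))
      (ih fun j hj => hx j (by simp [hj])))

/-- The images of the variables lie in a common `W d`, so monomials with exponents at most m land in
`W (m * (r * d))`, where injectivity keeps them independent. A general index is rounded down to such
a multiple. -/
theorem IsStandardFiltration.exists_pow_le_finrank (hW : IsStandardFiltration W) {r : ℕ}
    (g : MvPolynomial (Fin r) k →ₐ[k] F) (hg : Function.Injective g) :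
    ∃ D : ℕ, ∀ n, (n + 1) ^ r ≤ D * Module.finrank k (W n) := by
  have hfin (n) : Module.Finite k (W n) := Module.Finite.iff_fg.2 (hW.fg n)
  obtain ⟨d, hd⟩ := (Submodule.fg_span (R := k) (Set.finite_range fun i => g (X i))
    ).exists_le_of_monotone hW.mono hW.exhaustive
  have hX (i) : g (X i) ∈ W d := hd (Submodule.subset_span ⟨i, rfl⟩)
  have key (m : ℕ) : (m + 1) ^ r ≤ Module.finrank k (W (m * (r * d))) := by
    have hle : (restrictDegree (Fin r) k m).map g.toLinearMap ≤ W (m * (r * d)) := by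
      rw [restrictDegree, restrictSupport_eq_span, Submodule.map_span, Submodule.span_le]
      rintro _ ⟨_, ⟨s, hs, rfl⟩, rfl⟩
      have : g (monomial s 1) = ∏ i, g (X i) ^ s i := by
        rw [monomial_eq, map_mul, Finsupp.prod_fintype _ _ (by simp)]
        simp
      change g (monomial s 1) ∈ W _
      rw [this]
      refine hW.mono ?_ (hW.prod_mem _ _ _ fun i _ => hW.pow_mem (hX i) (s i))
      calc ∑ i, s i * d ≤ ∑ _i : Fin r, m * d :=
            Finset.sum_le_sum fun i _ => Nat.mul_le_mul_right _ (hs i)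
        _ = m * (r * d) := by simp; ring
    calc (m + 1) ^ r = Module.finrank k (restrictDegree (Fin r) k m) := by
          rw [finrank_restrictDegree, Fintype.card_fin]
      _ = Module.finrank k ((restrictDegree (Fin r) k m).map g.toLinearMap) :=
          ((Submodule.equivMapOfInjective g.toLinearMap hg _).finrank_eq)
      _ ≤ _ := Submodule.finrank_mono hle
  -- The extra 1 keeps the divisor positive when `r * d = 0`.
  refine ⟨(r * d + 1) ^ r, fun n => ?_⟩
  set c := r * d + 1
  have h1 : n + 1 ≤ c * (n / c + 1) := Nat.lt_mul_div_succ n (Nat.succ_pos _)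
  calc (n + 1) ^ r ≤ (c * (n / c + 1)) ^ r := Nat.pow_le_pow_left h1 r
    _ = c ^ r * (n / c + 1) ^ r := mul_pow _ _ _
    _ ≤ c ^ r * Module.finrank k (W n) := Nat.mul_le_mul_left _ ((key _).trans
        (Submodule.finrank_mono (hW.mono ?_)))
  exact (Nat.mul_le_mul_left _ (Nat.le_succ _)).trans (Nat.div_mul_le_self n c)

/-- Writing the products of `W 1` with the module generators in terms of these generators needs
coefficients of some bounded degree C. As `W (n + 1) ≤ W 1 * W n`, each step of the filtration
raises the degree of the coefficients by at most C. -/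
theorem IsStandardFiltration.exists_finrank_le_pow (hW : IsStandardFiltration W) {r : ℕ}
    (g : MvPolynomial (Fin r) k →ₐ[k] F) (hg : g.Finite) :
    ∃ K : ℕ, ∀ n, Module.finrank k (W n) ≤ K * (n + 1) ^ r := by
  obtain ⟨E, e, he⟩ : ∃ (E : ℕ) (e : Fin E → F), ∀ x, ∃ p : Fin E → MvPolynomial (Fin r) k,
      ∑ l, g (p l) * e l = x := by
    have hg' : g.toRingHom.Finite := hg
    algebraize [g.toRingHom]
    obtain ⟨E, e, he⟩ := Module.Finite.exists_fin (R := MvPolynomial (Fin r) k) (M := F)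
    refine ⟨E, e, fun x => ?_⟩
    have hx : x ∈ Submodule.span (MvPolynomial (Fin r) k) (Set.range e) := he ▸ trivial
    obtain ⟨p, hp⟩ := (Submodule.mem_span_range_iff_exists_fun _).1 hx
    exact ⟨p, by rw [← hp]; rfl⟩
  have hex (x : F) : ∃ c, x ∈ boundedCombinations g e c := by
    obtain ⟨p, rfl⟩ := he x
    refine ⟨Finset.univ.sup fun l => (p l).totalDegree, mem_boundedCombinations.2
      ⟨fun l => ⟨p l, restrictDegree_mono _ _ ?_ (mem_restrictDegree_totalDegree _)⟩, rfl⟩⟩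
    exact Finset.le_sup (f := fun l => (p l).totalDegree) (Finset.mem_univ l)
  -- One constant serves both the inductive step (`W 1` times the generators) and the base case `W
  -- 0`.
  obtain ⟨C, hC⟩ := (((hW.fg 1).mul (Submodule.fg_span (Set.finite_range e))).sup
    (hW.fg 0)).exists_le_of_monotone (boundedCombinations_mono g e) hex
  have hle (n : ℕ) : W n ≤ boundedCombinations g e (n * C + C) := by
    induction n with
    | zero => simpa using le_sup_right.trans hC
    | succ n ih =>
      refine (hW.succ_le n).trans (Submodule.mul_le.2 fun v hv x hx => ?_)
      obtain ⟨p, rfl⟩ := mem_boundedCombinations.1 (ih hx)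
      rw [Finset.mul_sum]
      refine Submodule.sum_mem _ fun l _ => ?_
      rw [mul_left_comm, Nat.succ_mul]
      exact mul_mem_boundedCombinations (p l).2 (hC (Submodule.mem_sup_left
        (Submodule.mul_mem_mul hv (Submodule.subset_span ⟨l, rfl⟩))))
  refine ⟨E * (C + 1) ^ r, fun n => ?_⟩
  calc Module.finrank k (W n) ≤ Module.finrank k (boundedCombinations g e (n * C + C)) :=
        Submodule.finrank_mono (hle n)
    _ ≤ E * (n * C + C + 1) ^ r := finrank_boundedCombinations_le g e _
    _ ≤ E * ((C + 1) * (n + 1)) ^ r :=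
        Nat.mul_le_mul_left _ (Nat.pow_le_pow_left (by ring_nf; omega) r)
    _ = E * (C + 1) ^ r * (n + 1) ^ r := by rw [mul_pow, mul_assoc]

theorem IsStandardFiltration.exists_growth [Nontrivial F] [Algebra.FiniteType k F]
    (hW : IsStandardFiltration W) : ∃ r D K : ℕ, ringKrullDim F ≤ r ∧
      (∀ n, (n + 1) ^ r ≤ D * Module.finrank k (W n)) ∧
      ∀ n, Module.finrank k (W n) ≤ K * (n + 1) ^ r := by
  obtain ⟨r, g, hinj, hfin⟩ := exists_finite_inj_algHom_of_fg k F
  obtain ⟨D, hD⟩ := hW.exists_pow_le_finrank g hinj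
  obtain ⟨K, hK⟩ := hW.exists_finrank_le_pow g hfin
  refine ⟨r, D, K, ?_, hD, hK⟩
  have hdim : ringKrullDim (MvPolynomial (Fin r) k) = r := by
    rw [MvPolynomial.ringKrullDim_of_isNoetherianRing]
    simp
  rw [← hdim]
  have hfin' : g.toRingHom.Finite := hfin
  algebraize [g.toRingHom]
  have : Algebra.IsIntegral (MvPolynomial (Fin r) k) F := Algebra.IsIntegral.of_finite _ _
  exact ringKrullDim_le_of_isIntegral _ _

end Growth

/-- Nakayama: minimal generators of N correspond to a basis of N/mN over the residue field. -/
theorem Module.length_quotient_maximalIdeal_smul_top {R M : Type*} [CommRing R] [IsLocalRing R]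
    [AddCommGroup M] [Module R M] (N : Submodule R M) (hN : N.FG) :
    Module.length R (N ⧸ maximalIdeal R • (⊤ : Submodule R N)) = N.spanFinrank := by
  let := Ideal.Quotient.field (maximalIdeal R)
  have : Module.Finite R N := Module.Finite.iff_fg.2 hN
  have : Module.Finite (R ⧸ maximalIdeal R) (N ⧸ maximalIdeal R • (⊤ : Submodule R N)) :=
    Module.Finite.of_restrictScalars_finite R _ _
  rw [spanFinrank_eq_finrank_quotient N hN, Module.length_eq_of_surjective
    (R := R ⧸ maximalIdeal R) Ideal.Quotient.mk_surjective, Module.length_eq_finrank]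

/-! ### Graded pieces of the Rees algebra -/

section ReesAlgebra

variable {R : Type*} [CommRing R] (a : Ideal R)

/-- The inclusion of `a ^ i` as the degree `i` part of the Rees algebra. -/
noncomputable def reesMonomial (i : ℕ) : ↥(a ^ i) →ₗ[R] reesAlgebra a :=
  LinearMap.codRestrict (Subalgebra.toSubmodule (reesAlgebra a))
    ((Polynomial.monomial i).comp (Submodule.subtype (a ^ i)))
    fun c => reesAlgebra.monomial_mem.2 c.2

@[simp]
theorem coe_reesMonomial (i : ℕ) (c : ↥(a ^ i)) :
    (reesMonomial a i c : Polynomial R) = Polynomial.monomial i (c : R) := rfl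

theorem reesAlgebra.eq_sum_reesMonomial (p : reesAlgebra a) {n : ℕ}
    (hn : (p : Polynomial R).natDegree ≤ n) :
    p = ∑ i : Fin (n + 1), reesMonomial a i ⟨(p : Polynomial R).coeff i, p.2 i⟩ := by
  apply Subtype.ext
  rw [AddSubmonoidClass.coe_finsetSum]
  simp only [coe_reesMonomial]
  rw [Fin.sum_univ_eq_sum_range
    (fun i => Polynomial.monomial i ((p : Polynomial R).coeff i)) (n + 1)]
  exact Polynomial.as_sum_range' _ _ (Nat.lt_succ_of_le hn)

/-- The extended ideal is `J • ⊤` as an `R`-module, and multiplication by J respects the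
decomposition by degree. This identifies the degree i part of the fiber ring with `a ^ i` modulo `m
a ^ i`. -/
theorem reesAlgebra.mem_map_iff (J : Ideal R) (p : reesAlgebra a) :
    p ∈ J.map (algebraMap R (reesAlgebra a)) ↔ ∀ i, (p : Polynomial R).coeff i ∈ J * a ^ i := by
  have hmem (q : reesAlgebra a) : q ∈ J.map (algebraMap R (reesAlgebra a)) ↔
      q ∈ J • (⊤ : Submodule R (reesAlgebra a)) := by
    rw [Ideal.smul_top_eq_map]; rfl
  constructor
  · intro h i
    refine Submodule.smul_induction_on ((hmem p).1 h) (fun r hr q _ => ?_) fun x y hx hy => ?_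
    · simpa using Ideal.mul_mem_mul hr (q.2 i)
    · simpa using add_mem hx hy
  · intro h
    rw [hmem, reesAlgebra.eq_sum_reesMonomial a p le_rfl]
    refine Submodule.sum_mem _ fun i _ => ?_
    have : (⟨(p : Polynomial R).coeff i, p.2 i⟩ : ↥(a ^ (i : ℕ))) ∈
        J • (⊤ : Submodule R ↥(a ^ (i : ℕ))) :=
      (Submodule.mem_smul_top_iff _ _ _).2 (h i)
    have := Submodule.mem_map_of_mem (f := reesMonomial a i) this
    rw [Submodule.map_smul''] at this
    exact Submodule.smul_mono le_rfl le_top this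

end ReesAlgebra

/-! ### The degree filtration of the fiber ring and its growth -/

section FiberRing

variable {R : Type*} [CommRing R] [IsLocalRing R] (a : Ideal R)

/-- The part of degree at most `n` of the fiber ring. -/
noncomputable def fiberFiltration (n : ℕ) : Submodule (R ⧸ maximalIdeal R) (FiberRing a) where
  carrier := {x | ∃ p : reesAlgebra a, (p : Polynomial R).natDegree ≤ n ∧
    Ideal.Quotient.mk _ p = x}
  zero_mem' := ⟨0, by simp, map_zero _⟩
  add_mem' := by
    rintro _ _ ⟨p, hp, rfl⟩ ⟨q, hq, rfl⟩
    exact ⟨p + q, Polynomial.natDegree_add_le_of_degree_le hp hq, map_add _ _ _⟩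
  smul_mem' := by
    rintro c _ ⟨p, hp, rfl⟩
    obtain ⟨c, rfl⟩ := Ideal.Quotient.mk_surjective c
    exact ⟨c • p, (Polynomial.natDegree_smul_le _ _).trans hp, rfl⟩

/-- The surjection from `⨁ i ≤ n, a ^ i` onto the part of degree at most `n` of the fiber ring. -/
noncomputable def toFiberFiltration (n : ℕ) :
    (Π i : Fin (n + 1), ↥(a ^ (i : ℕ))) →ₗ[R] fiberFiltration a n :=
  LinearMap.codRestrict ((fiberFiltration a n).restrictScalars R)
    ((Ideal.Quotient.mkₐ R ((maximalIdeal R).map (algebraMap R (reesAlgebra a)))).toLinearMap ∘ₗ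
      ∑ i : Fin (n + 1), reesMonomial a i ∘ₗ LinearMap.proj i)
    fun c => by
      refine ⟨_, ?_, rfl⟩
      simp only [LinearMap.sum_apply, AddSubmonoidClass.coe_finsetSum, LinearMap.comp_apply,
        coe_reesMonomial]
      exact Polynomial.natDegree_sum_le_of_forall_le _ _ fun i _ =>
        (Polynomial.natDegree_monomial_le _).trans (Nat.le_of_lt_succ i.2)

theorem coe_toFiberFiltration (n : ℕ) (c : Π i : Fin (n + 1), ↥(a ^ (i : ℕ))) :
    (toFiberFiltration a n c : FiberRing a) =
      Ideal.Quotient.mk _ (∑ i : Fin (n + 1), reesMonomial a i (c i)) := by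
  change Ideal.Quotient.mk _ ((∑ i : Fin (n + 1), reesMonomial a i ∘ₗ LinearMap.proj i) c) = _
  rw [LinearMap.sum_apply]
  rfl

theorem toFiberFiltration_surjective (n : ℕ) : Function.Surjective (toFiberFiltration a n) := by
  rintro ⟨_, p, hp, rfl⟩
  refine ⟨fun i => ⟨(p : Polynomial R).coeff i, p.2 i⟩, Subtype.ext ?_⟩
  rw [coe_toFiberFiltration, ← reesAlgebra.eq_sum_reesMonomial a p hp]

theorem ker_toFiberFiltration (n : ℕ) : LinearMap.ker (toFiberFiltration a n) =
    Submodule.pi Set.univ fun i : Fin (n + 1) =>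
      maximalIdeal R • (⊤ : Submodule R ↥(a ^ (i : ℕ))) := by
  ext c
  have hc (j : ℕ) :
      ((∑ i : Fin (n + 1), reesMonomial a i (c i) : reesAlgebra a) : Polynomial R).coeff j =
      if h : j < n + 1 then (c ⟨j, h⟩ : R) else 0 := by
    rw [AddSubmonoidClass.coe_finsetSum, Polynomial.finsetSum_coeff]
    simp only [coe_reesMonomial, Polynomial.coeff_monomial]
    split_ifs with h
    · rw [Finset.sum_eq_single ⟨j, h⟩ (fun i _ hi => if_neg fun e => hi (Fin.ext e)) (by simp)]
      simp
    · exact Finset.sum_eq_zero fun i _ => if_neg fun e : (i : ℕ) = j => h (e ▸ i.2)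
  rw [LinearMap.mem_ker, ← Submodule.coe_eq_zero, coe_toFiberFiltration,
    Ideal.Quotient.eq_zero_iff_mem, reesAlgebra.mem_map_iff]
  simp only [hc, Submodule.mem_pi, Set.mem_univ, true_imp_iff, Submodule.mem_smul_top_iff]
  constructor
  · intro h i
    have := h i
    rwa [dif_pos i.2] at this
  · intro h j
    split_ifs with hj
    · exact h ⟨j, hj⟩
    · exact zero_mem _

theorem length_fiberFiltration [IsNoetherianRing R] (n : ℕ) :
    Module.length R (fiberFiltration a n) =
      ∑ i ∈ Finset.range (n + 1), ((a ^ i).spanFinrank : ℕ∞) := by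
  rw [← ((toFiberFiltration a n).quotKerEquivOfSurjective
    (toFiberFiltration_surjective a n)).length_eq, ker_toFiberFiltration,
    (Submodule.quotientPi _).length_eq, Module.length_pi_of_fintype,
    Finset.sum_range]
  exact Finset.sum_congr rfl fun i _ =>
    Module.length_quotient_maximalIdeal_smul_top _ (IsNoetherian.noetherian _)

theorem fg_fiberFiltration [IsNoetherianRing R] (n : ℕ) : (fiberFiltration a n).FG := by
  rw [← Module.Finite.iff_fg]
  have : Module.Finite R (fiberFiltration a n) :=
    Module.Finite.of_surjective _ (toFiberFiltration_surjective a n)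
  exact Module.Finite.of_restrictScalars_finite R _ _

theorem fiberFiltration_mono : Monotone (fiberFiltration a) :=
  fun _ _ h _ ⟨p, hp, hx⟩ => ⟨p, hp.trans h, hx⟩

theorem mk_reesMonomial_mem_fiberFiltration (i : ℕ) (c : ↥(a ^ i)) :
    (Ideal.Quotient.mk _ (reesMonomial a i c) : FiberRing a) ∈ fiberFiltration a i :=
  ⟨_, Polynomial.natDegree_monomial_le _, rfl⟩

theorem one_mem_fiberFiltration (n : ℕ) : (1 : FiberRing a) ∈ fiberFiltration a n :=
  ⟨1, by simp, map_one _⟩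

/-- The Rees algebra is generated in degree one: the top component is handled by `a ^ (n + 1) = a *
a ^ n`, the lower ones by `1 ∈ fiberFiltration a 1`. -/
theorem fiberFiltration_succ_le (n : ℕ) :
    fiberFiltration a (n + 1) ≤ fiberFiltration a 1 * fiberFiltration a n := by
  have hle : fiberFiltration a n ≤ fiberFiltration a 1 * fiberFiltration a n := fun x hx => by
    simpa using Submodule.mul_mem_mul (one_mem_fiberFiltration a 1) hx
  rintro _ ⟨p, hp, rfl⟩
  rw [reesAlgebra.eq_sum_reesMonomial a p hp, map_sum]
  refine Submodule.sum_mem _ fun i _ => ?_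
  generalize (⟨(p : Polynomial R).coeff i, p.2 i⟩ : ↥(a ^ (i : ℕ))) = c
  obtain ⟨i, hi⟩ := i
  rcases Nat.lt_succ_iff_lt_or_eq.1 hi with hi | rfl
  · exact hle (fiberFiltration_mono a (Nat.le_of_lt_succ hi)
      (mk_reesMonomial_mem_fiberFiltration a i c))
  · obtain ⟨c, hc⟩ := c
    have hc' : c ∈ a * a ^ n := by rwa [← pow_succ']
    refine Submodule.mul_induction_on' (C := fun x hx =>
      Ideal.Quotient.mk _ (reesMonomial a (n + 1) ⟨x, by rwa [pow_succ']⟩) ∈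
        fiberFiltration a 1 * fiberFiltration a n) (fun x hx y hy => ?_)
      (fun x hx y hy h1 h2 => ?_) hc'
    · have : reesMonomial a (n + 1) ⟨x * y, by rw [pow_succ']; exact Ideal.mul_mem_mul hx hy⟩ =
          reesMonomial a 1 ⟨x, by simpa using hx⟩ * reesMonomial a n ⟨y, hy⟩ := by
        apply Subtype.ext
        simp [Polynomial.monomial_mul_monomial, add_comm]
      rw [this, map_mul]
      exact Submodule.mul_mem_mul (mk_reesMonomial_mem_fiberFiltration a 1 _)
        (mk_reesMonomial_mem_fiberFiltration a n _)
    · have := add_mem h1 h2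
      rw [← map_add, ← map_add] at this
      exact this

theorem isStandardFiltration_fiberFiltration [IsNoetherianRing R] :
    IsStandardFiltration (k := R ⧸ maximalIdeal R) (F := FiberRing a) (fiberFiltration a) where
  mono := fiberFiltration_mono a
  one_mem := one_mem_fiberFiltration a 0
  mul_le i j := Submodule.mul_le.2 <| by
    rintro _ ⟨p, hp, rfl⟩ _ ⟨q, hq, rfl⟩
    exact ⟨p * q, Polynomial.natDegree_mul_le_of_le hp hq, map_mul _ _ _⟩
  succ_le := fiberFiltration_succ_le a
  exhaustive x := by
    obtain ⟨p, rfl⟩ := Ideal.Quotient.mk_surjective x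
    exact ⟨_, p, le_rfl, rfl⟩
  fg := fg_fiberFiltration a

theorem exists_growth_fiberRing [IsNoetherianRing R] : ∃ r D K : ℕ, analyticSpread a ≤ r ∧
    (∀ n, (n + 1) ^ r ≤ D * ∑ i ∈ Finset.range (n + 1), (a ^ i).spanFinrank) ∧
      ∀ n, ∑ i ∈ Finset.range (n + 1), (a ^ i).spanFinrank ≤ K * (n + 1) ^ r := by
  let := Ideal.Quotient.field (maximalIdeal R)
  have hfin (n : ℕ) : Module.Finite (R ⧸ maximalIdeal R) (fiberFiltration a n) :=
    Module.Finite.iff_fg.2 (fg_fiberFiltration a n)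
  have hrank (n : ℕ) : Module.finrank (R ⧸ maximalIdeal R) (fiberFiltration a n) =
      ∑ i ∈ Finset.range (n + 1), (a ^ i).spanFinrank := by
    have h := length_fiberFiltration a n
    rw [Module.length_eq_of_surjective (R := R ⧸ maximalIdeal R) Ideal.Quotient.mk_surjective,
      Module.length_eq_finrank] at h
    exact_mod_cast h
  -- If the fiber ring were zero, the degree 0 coefficient of 1 would lie in the maximal ideal.
  have : Nontrivial (FiberRing a) := by
    refine Ideal.Quotient.nontrivial_iff.2 fun h => ?_
    have h1 := (reesAlgebra.mem_map_iff a (maximalIdeal R) 1).1 (by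
      rw [h]; exact Submodule.mem_top) 0
    simp only [pow_zero, Ideal.one_eq_top, Ideal.mul_top] at h1
    exact (mem_maximalIdeal _).1 h1 (by simp)
  have : Algebra.FiniteType R (reesAlgebra a) :=
    (reesAlgebra a).fg_iff_finiteType.1 (reesAlgebra.fg (IsNoetherian.noetherian a))
  have : Algebra.FiniteType R (FiberRing a) :=
    this.of_surjective (Ideal.Quotient.mkₐ R _) Ideal.Quotient.mk_surjective
  have : Algebra.FiniteType (R ⧸ maximalIdeal R) (FiberRing a) :=
    Algebra.FiniteType.of_restrictScalars_finiteType R _ _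
  simpa only [analyticSpread, hrank] using (isStandardFiltration_fiberFiltration a).exists_growth

end FiberRing

/-! ### Length estimates for quotients -/

section Length

variable {R M : Type*} [CommRing R] [AddCommGroup M] [Module R M]

/-- Additivity on 0 → P/(P ∩ Q) → M/Q → M/(P + Q) → 0. -/
theorem Module.length_quotient_eq_add (P Q : Submodule R M) :
    Module.length R (M ⧸ Q) =
      Module.length R (P ⧸ Q.comap P.subtype) + Module.length R (M ⧸ (P ⊔ Q)) := by
  refine Module.length_eq_add_of_exact ((Q.comap P.subtype).mapQ Q P.subtype le_rfl)
    (Submodule.factor (le_sup_right : Q ≤ P ⊔ Q)) ?_ (Submodule.factor_surjective _) ?_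
  · rw [← LinearMap.ker_eq_bot, Submodule.ker_mapQ, Submodule.mkQ_map_self]
  · rw [LinearMap.exact_iff, Submodule.range_mapQ, Submodule.range_subtype, Submodule.factor,
      Submodule.ker_mapQ, Submodule.comap_id, Submodule.map_sup, Submodule.mkQ_map_self, sup_bot_eq]

theorem Module.length_quotient_le {P Q : Submodule R M} (h : P ≤ Q) :
    Module.length R (M ⧸ Q) ≤ Module.length R (M ⧸ P) :=
  Module.length_le_of_surjective (Submodule.factor h) (Submodule.factor_surjective h)

theorem Module.length_quotient_smul_top_le (J : Ideal R) (N : Submodule R M) (hN : N.FG) :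
    Module.length R (N ⧸ J • (⊤ : Submodule R N)) ≤ N.spanFinrank * Module.length R (R ⧸ J) := by
  classical
  obtain ⟨s, hs, hspan⟩ := hN.exists_span_finset_card_eq_spanFinrank
  have hmem (x : s) : (x : M) ∈ N := hspan ▸ Submodule.subset_span x.2
  let f : (s → R) →ₗ[R] N := Fintype.linearCombination R fun x : s => (⟨x, hmem x⟩ : N)
  have hf : Function.Surjective f := by
    rintro ⟨y, hy⟩
    rw [← hspan] at hy
    obtain ⟨c, hc⟩ := Submodule.mem_span_finset'.1 hy
    exact ⟨c, Subtype.ext (by simpa [f, Fintype.linearCombination_apply] using hc)⟩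
  have hle : Submodule.pi Set.univ (fun _ : s => (J : Submodule R R)) ≤
      (J • (⊤ : Submodule R N)).comap f := by
    intro c hc
    simp only [f, Submodule.mem_comap, Fintype.linearCombination_apply]
    exact Submodule.sum_mem _ fun i _ => Submodule.smul_mem_smul (hc i trivial) trivial
  refine (Module.length_le_of_surjective (Submodule.mapQ _ _ f hle) ?_).trans ?_
  · rw [← LinearMap.range_eq_top, Submodule.range_mapQ, LinearMap.range_eq_top.2 hf,
      Submodule.map_top, Submodule.range_mkQ]
  · rw [(Submodule.quotientPi _).length_eq, Module.length_pi]
    simp [← hs]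

/-- The kernel of R/(J + (xy)) → R/(J + (x)) is generated by x, and multiplication by x maps R/(J +
(y)) onto it. -/
theorem Ideal.length_quotient_sup_span_mul_le (J : Ideal R) (x y : R) :
    Module.length R (R ⧸ (J ⊔ Ideal.span {x * y})) ≤
      Module.length R (R ⧸ (J ⊔ Ideal.span {x})) + Module.length R (R ⧸ (J ⊔ Ideal.span {y})) := by
  rw [Module.length_quotient_eq_add (Ideal.span {x}) (J ⊔ Ideal.span {x * y}), add_comm]
  have hx : Ideal.span {x} ⊔ (J ⊔ Ideal.span {x * y}) = J ⊔ Ideal.span {x} := by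
    rw [sup_left_comm, sup_of_le_left
      (Ideal.span_singleton_le_span_singleton.2 (dvd_mul_right x y))]
  refine add_le_add (hx ▸ le_rfl) ?_
  let f : R →ₗ[R] Ideal.span {x} :=
    LinearMap.toSpanSingleton R _ ⟨x, Ideal.mem_span_singleton_self x⟩
  have hf : Function.Surjective f := by
    rintro ⟨z, hz⟩
    obtain ⟨c, rfl⟩ := Ideal.mem_span_singleton'.1 hz
    exact ⟨c, rfl⟩
  refine Module.length_le_of_surjective (Submodule.mapQ _ _ f ?_) ?_
  · intro c hc
    change c * x ∈ J ⊔ Ideal.span {x * y}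
    obtain ⟨u, hu, v, hv, rfl⟩ := Submodule.mem_sup.1 hc
    obtain ⟨w, rfl⟩ := Ideal.mem_span_singleton'.1 hv
    rw [add_mul]
    refine Submodule.add_mem_sup (J.mul_mem_right _ hu) ?_
    exact Ideal.mem_span_singleton'.2 ⟨w, by ring⟩
  · rw [← LinearMap.range_eq_top, Submodule.range_mapQ, LinearMap.range_eq_top.2 hf,
      Submodule.map_top, Submodule.range_mkQ]

theorem Ideal.length_quotient_sup_span_pow_le (J : Ideal R) (x : R) (n : ℕ) :
    Module.length R (R ⧸ (J ⊔ Ideal.span {x ^ n})) ≤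
      n * Module.length R (R ⧸ (J ⊔ Ideal.span {x})) := by
  induction n with
  | zero =>
    have : Subsingleton (R ⧸ (J ⊔ Ideal.span {x ^ 0})) :=
      Ideal.Quotient.subsingleton_iff.2 (by simp)
    simp
  | succ n ih =>
    rw [pow_succ, Nat.cast_succ, add_mul, one_mul]
    exact (J.length_quotient_sup_span_mul_le _ _).trans (add_le_add_left ih _)

theorem Ideal.length_quotient_sup_span_image_pow_le (J : Ideal R) (s : Finset R) (n : ℕ) :
    Module.length R (R ⧸ (J ⊔ Ideal.span ((· ^ n) '' (s : Set R)))) ≤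
      (n ^ s.card : ℕ) * Module.length R (R ⧸ (J ⊔ Ideal.span (s : Set R))) := by
  classical
  induction s using Finset.induction_on generalizing J with
  | empty =>
    rw [Finset.coe_empty, Set.image_empty, Finset.card_empty, pow_zero, Nat.cast_one, one_mul]
  | insert x s hx ih =>
    rw [Finset.coe_insert, Set.image_insert_eq, Ideal.span_insert, ← sup_assoc,
      Finset.card_insert_of_notMem hx, Ideal.span_insert]
    -- The induction hypothesis is used with `x ^ n` absorbed into `J`. The remaining factor n comes
    -- from replacing `x ^ n` by x modulo `J` and `s`.
    refine (ih _).trans ?_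
    rw [pow_succ, Nat.cast_mul, mul_assoc]
    have h := (J ⊔ Ideal.span (s : Set R)).length_quotient_sup_span_pow_le x n
    rw [sup_right_comm, sup_right_comm J _ (Ideal.span {x}), sup_assoc J (Ideal.span {x})] at h
    exact mul_le_mul_right h _

end Length

/-! ### The increments of the lengths -/

section Powers

variable {R : Type*} [CommRing R]

theorem Ideal.sup_pow_le_sup_pow (a b : Ideal R) (n : ℕ) : (a ⊔ b) ^ n ≤ b ⊔ a ^ n := by
  induction n with
  | zero => simp
  | succ n ih =>
    rw [pow_succ, pow_succ]
    have h1 : b * (a ⊔ b) ≤ b := Ideal.mul_le_left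
    have h2 : a ^ n * b ≤ b := Ideal.mul_le_right
    calc (a ⊔ b) ^ n * (a ⊔ b) ≤ (b ⊔ a ^ n) * (a ⊔ b) := Ideal.mul_mono_left ih
      _ = b * (a ⊔ b) ⊔ (a ^ n * a ⊔ a ^ n * b) := by rw [Ideal.sup_mul, Ideal.mul_sup (a ^ n)]
      _ ≤ b ⊔ a ^ n * a :=
        sup_le (h1.trans le_sup_left) (sup_le le_sup_right (h2.trans le_sup_left))

theorem length_quotient_sup_pow_succ (a b : Ideal R) (n : ℕ) :
    Module.length R (R ⧸ (b ⊔ a ^ (n + 1))) = Module.length R (R ⧸ (b ⊔ a ^ n)) +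
      Module.length R (↥(a ^ n) ⧸ Submodule.comap (Submodule.subtype (a ^ n)) (b ⊔ a ^ (n + 1))) := by
  have hle : a ^ (n + 1) ≤ a ^ n := Ideal.pow_le_pow_right n.le_succ
  have : a ^ n ⊔ (b ⊔ a ^ (n + 1)) = b ⊔ a ^ n := by
    rw [sup_left_comm, sup_of_le_left hle]
  rw [Module.length_quotient_eq_add (a ^ n) (b ⊔ a ^ (n + 1)), this, add_comm]

/-- Since `(a ⊔ b) * a ^ n ≤ b ⊔ a ^ (n + 1)`, the increment is a quotient of `a ^ n` modulo `(a ⊔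
b) * a ^ n`, onto which a sum of copies of `R ⧸ (a ⊔ b)`, one for each generator, maps. -/
theorem length_pow_quotient_comap_le [IsNoetherianRing R] (a b : Ideal R) (n : ℕ) :
    Module.length R (↥(a ^ n) ⧸ Submodule.comap (Submodule.subtype (a ^ n)) (b ⊔ a ^ (n + 1))) ≤
      (a ^ n).spanFinrank * Module.length R (R ⧸ (a ⊔ b)) := by
  refine (Module.length_quotient_le ?_).trans
    (Module.length_quotient_smul_top_le (a ⊔ b) (a ^ n) (IsNoetherian.noetherian _))
  refine Submodule.smul_le.2 fun r hr x _ => ?_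
  change r * (x : R) ∈ b ⊔ a ^ (n + 1)
  obtain ⟨u, hu, v, hv, rfl⟩ := Submodule.mem_sup.1 hr
  rw [add_mul, add_comm (u * _), pow_succ']
  exact Submodule.add_mem_sup (b.mul_mem_right _ hv) (Ideal.mul_mem_mul hu x.2)

end Powers

/-! ### Parameters modulo b, and the lower bound for the increments -/

section LocalRing

variable {R : Type*} [CommRing R] [IsLocalRing R] [IsNoetherianRing R]

theorem IsLocalRing.isFiniteLength_quotient {J : Ideal R} {c : ℕ} (h : maximalIdeal R ^ c ≤ J) :
    IsFiniteLength R (R ⧸ J) := by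
  rcases subsingleton_or_nontrivial (R ⧸ J) with hJ | hJ
  · exact .of_subsingleton
  have : IsLocalRing (R ⧸ J) := .of_surjective' _ Ideal.Quotient.mk_surjective
  have hA : IsArtinianRing (R ⧸ J) := by
    rw [isArtinianRing_iff_isNilpotent_maximalIdeal]
    refine ⟨c, ?_⟩
    rw [← IsLocalRing.map_maximalIdeal_of_surjective _ Ideal.Quotient.mk_surjective,
      ← Ideal.map_pow]
    exact le_bot_iff.1 ((Ideal.map_mono h).trans_eq (Ideal.map_quotient_self J))
  rw [← Module.length_ne_top_iff, Module.length_eq_of_surjective (R := R ⧸ J)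
    Ideal.Quotient.mk_surjective]
  exact Module.length_ne_top

/-- By the converse of Krull's height theorem, the maximal ideal of `R ⧸ b` is minimal over an ideal
with as many generators as its height; these are lifted to `R`. -/
theorem IsLocalRing.exists_parameters (b : Ideal R) (hb : b ≠ ⊤) : ∃ s : Finset R, ∃ c : ℕ,
    (s.card : WithBot ℕ∞) ≤ ringKrullDim (R ⧸ b) ∧ (s : Set R) ⊆ maximalIdeal R ∧
      maximalIdeal R ^ c ≤ b ⊔ Ideal.span s := by
  classical
  have : Nontrivial (R ⧸ b) := Ideal.Quotient.nontrivial_iff.2 hb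
  have : IsLocalRing (R ⧸ b) := .of_surjective' _ Ideal.Quotient.mk_surjective
  obtain ⟨t, ht, hcard⟩ := Ideal.exists_finset_card_eq_height_of_isNoetherianRing
    (maximalIdeal (R ⧸ b))
  have hmax := IsLocalRing.map_maximalIdeal_of_surjective (Ideal.Quotient.mk b)
    Ideal.Quotient.mk_surjective
  -- Every prime over the span of `t` lies in the maximal ideal, hence contains it by minimality.
  have hrad : maximalIdeal (R ⧸ b) ≤ (Ideal.span (t : Set (R ⧸ b))).radical := by
    rw [Ideal.radical_eq_sInf]
    refine le_sInf fun p ⟨hp, hpp⟩ => ht.2 ⟨hpp, hp⟩ (le_maximalIdeal hpp.ne_top)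
  obtain ⟨c, hc⟩ := Ideal.exists_radical_pow_le_of_fg (Ideal.span (t : Set (R ⧸ b)))
    (IsNoetherian.noetherian _)
  have himage : Ideal.Quotient.mk b '' (t.image Quotient.out : Finset R) = t := by
    simp [Set.image_image]
  refine ⟨t.image Quotient.out, c, ?_, ?_, ?_⟩
  · rw [← maximalIdeal_height_eq_ringKrullDim, ← hcard]
    exact_mod_cast Finset.card_image_le
  · intro x hx
    have hx' : Ideal.Quotient.mk b x ∈ maximalIdeal (R ⧸ b) :=
      ht.1.2 (Ideal.subset_span (himage ▸ Set.mem_image_of_mem _ hx))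
    rw [SetLike.mem_coe, mem_maximalIdeal, mem_nonunits_iff] at *
    exact fun hu => hx' (hu.map _)
  · have h1 : (maximalIdeal R ^ c).map (Ideal.Quotient.mk b) ≤
        (Ideal.span ((t.image Quotient.out : Finset R) : Set R)).map (Ideal.Quotient.mk b) := by
      rw [Ideal.map_pow, hmax, Ideal.map_span, himage]
      exact (Ideal.pow_right_mono hrad c).trans hc
    rw [Ideal.map_le_iff_le_comap, Ideal.comap_map_of_surjective' _ Ideal.Quotient.mk_surjective,
      Ideal.mk_ker, sup_comm] at h1
    exact h1

variable {a b : Ideal R}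

/-- For a parameter x, the power `x ^ (c * n)` lies in `(a ⊔ b) ^ n ≤ b ⊔ a ^ n`. Hence the length
is at most that modulo b and these powers, which is at most `(c * n) ^ δ` times a constant. -/
theorem exists_length_quotient_sup_pow_le {c : ℕ} (hc : maximalIdeal R ^ c ≤ a ⊔ b) (hb : b ≠ ⊤) :
    ∃ δ K : ℕ, (δ : WithBot ℕ∞) ≤ ringKrullDim (R ⧸ b) ∧
      ∀ n, Module.length R (R ⧸ (b ⊔ a ^ n)) ≤ (K * n ^ δ : ℕ) := by
  obtain ⟨s, e, hcard, hs, he⟩ := exists_parameters b hb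
  obtain ⟨L, hL⟩ := ENat.ne_top_iff_exists.1
    (Module.length_ne_top_iff.2 (isFiniteLength_quotient he))
  refine ⟨s.card, c ^ s.card * L, hcard, fun n => ?_⟩
  have hle : b ⊔ Ideal.span ((· ^ (c * n)) '' (s : Set R)) ≤ b ⊔ a ^ n := by
    refine sup_le le_sup_left (Ideal.span_le.2 ?_)
    rintro _ ⟨x, hx, rfl⟩
    refine Ideal.sup_pow_le_sup_pow a b n ?_
    simp only [pow_mul]
    exact Ideal.pow_mem_pow (hc (Ideal.pow_mem_pow (hs hx) c)) n
  refine (Module.length_quotient_le hle).trans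
    ((Ideal.length_quotient_sup_span_image_pow_le b s (c * n)).trans ?_)
  rw [← hL, mul_pow]
  norm_cast
  exact le_of_eq (by ring)

/-- By the modular law `a ^ n ⊓ (b ⊔ a ^ (n + 1))` equals `(b ⊓ a ^ n) ⊔ a ^ (n + 1)`, and both
terms lie in `m a ^ n`. So the increment maps onto `a ^ n` modulo `m a ^ n`. -/
theorem spanFinrank_le_length_pow_quotient_comap {n : ℕ} (ha : a ≤ maximalIdeal R)
    (h : b ⊓ a ^ n ≤ maximalIdeal R * a ^ n) :
    ((a ^ n).spanFinrank : ℕ∞) ≤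
      Module.length R (↥(a ^ n) ⧸ Submodule.comap (Submodule.subtype (a ^ n)) (b ⊔ a ^ (n + 1))) := by
  rw [← Module.length_quotient_maximalIdeal_smul_top _ (IsNoetherian.noetherian _)]
  refine Module.length_quotient_le fun x hx => ?_
  rw [Submodule.mem_smul_top_iff]
  obtain ⟨y, hy, z, hz, hyz⟩ := Submodule.mem_sup.1 hx
  have hz' : z ∈ maximalIdeal R * a ^ n := by
    rw [pow_succ'] at hz
    exact Ideal.mul_mono_left ha hz
  have hyx : y = x - z := eq_sub_of_add_eq hyz
  have hy' : y ∈ a ^ n := by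
    rw [hyx]
    exact sub_mem x.2 (Ideal.pow_le_pow_right n.le_succ hz)
  have : (x : R) = y + z := hyz.symm
  rw [this]
  exact add_mem (h ⟨hy, hy'⟩) hz'

end LocalRing

/-! ### Comparing exponents and polynomial bounds -/

section Numeric

theorem Nat.le_of_forall_pow_le_mul_pow {r d C : ℕ} (h : ∀ n, 1 ≤ n → n ^ r ≤ C * n ^ d) :
    r ≤ d := by
  by_contra! hlt
  have h1 := h (C + 1) (Nat.le_add_left 1 C)
  have h2 : (C + 1) ^ (d + 1) ≤ (C + 1) ^ r := Nat.pow_le_pow_right (Nat.succ_pos C) hlt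
  have h3 : (C + 1) ^ (d + 1) ≤ C * (C + 1) ^ d := h2.trans h1
  rw [pow_succ'] at h3
  have := Nat.le_of_mul_le_mul_right h3 (pow_pos (Nat.succ_pos C) d)
  omega

theorem GrowsLikePow.of_pow_bounds {v : ℕ → ℕ∞} {u : ℕ → ℕ} {r D K : ℕ} (hv : ∀ n, v n = u n)
    (hu : ∀ n, 1 ≤ n → 1 ≤ u n) (h1 : ∀ n, 1 ≤ n → n ^ r ≤ D * u n)
    (h2 : ∀ n, 1 ≤ n → u n ≤ K * n ^ r) : GrowsLikePow v r := by
  -- The bounds at n = 1 force D and K to be positive, hence the leading coefficients `D⁻¹` and `K`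
  -- too.
  have hD : 0 < D := by
    have := h1 1 le_rfl
    rw [one_pow] at this
    exact pos_of_mul_pos_left (Nat.lt_of_succ_le this) (Nat.zero_le _)
  have hK : 0 < K := by
    have := (hu 1 le_rfl).trans (h2 1 le_rfl)
    rwa [one_pow, mul_one] at this
  have hD' : (0 : ℝ) < (D : ℝ)⁻¹ := inv_pos.2 (Nat.cast_pos.2 hD)
  have hK' : (0 : ℝ) < K := Nat.cast_pos.2 hK
  refine ⟨.C (D : ℝ)⁻¹ * .X ^ r, .C (K : ℝ) * .X ^ r, ?_, ?_, ?_, ?_, ?_⟩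
  · exact Polynomial.natDegree_C_mul_X_pow r _ hD'.ne'
  · rwa [Polynomial.leadingCoeff_C_mul_X_pow]
  · exact Polynomial.natDegree_C_mul_X_pow r _ hK'.ne'
  · rwa [Polynomial.leadingCoeff_C_mul_X_pow]
  · filter_upwards [eventually_ge_atTop 1] with n hn
    refine ⟨u n, hv n, ?_, ?_⟩
    · simp only [Polynomial.eval_mul, Polynomial.eval_C, Polynomial.eval_pow, Polynomial.eval_X]
      rw [inv_mul_le_iff₀ (Nat.cast_pos.2 hD)]
      exact_mod_cast h1 n hn
    · simp only [Polynomial.eval_mul, Polynomial.eval_C, Polynomial.eval_pow, Polynomial.eval_X]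
      exact_mod_cast h2 n hn

end Numeric

/-! ### Artin–Rees -/

section ArtinRees

variable {R : Type*} [CommRing R]

/-- The Artin–Rees lemma makes the defining set nonempty, so the infimum is attained and is not the
default value 0 of `sInf ∅`. -/
theorem artinReesNumber_spec [IsNoetherianRing R] (a b : Ideal R) {n : ℕ}
    (hn : artinReesNumber a b ≤ n) :
    b ⊓ a ^ n = a ^ (n - artinReesNumber a b) * (b ⊓ a ^ artinReesNumber a b) := by
  refine Nat.sInf_mem (s := {s : ℕ | ∀ n, s ≤ n → b ⊓ a ^ n = a ^ (n - s) * (b ⊓ a ^ s)}) ?_ n hn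
  obtain ⟨s, hs⟩ := Ideal.exists_pow_inf_eq_pow_smul a (b : Submodule R R)
  refine ⟨s, fun n hn => ?_⟩
  have h := hs n hn
  simp only [smul_eq_mul, Ideal.mul_top] at h
  rwa [inf_comm, inf_comm b]

/-- Beyond the Artin–Rees number, passing from n to m multiplies both sides by `a ^ (m - n)`. -/
theorem inf_pow_le_mul_of_le [IsNoetherianRing R] {a b J : Ideal R} {n m : ℕ}
    (hn : artinReesNumber a b ≤ n) (h : b ⊓ a ^ n ≤ J * a ^ n) (hnm : n ≤ m) :
    b ⊓ a ^ m ≤ J * a ^ m := by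
  have h1 : b ⊓ a ^ m = a ^ (m - n) * (b ⊓ a ^ n) := by
    rw [artinReesNumber_spec a b hn, artinReesNumber_spec a b (hn.trans hnm), ← mul_assoc,
      ← pow_add]
    congr 2
    omega
  have h2 : J * a ^ m = a ^ (m - n) * (J * a ^ n) := by
    rw [mul_left_comm, ← pow_add, Nat.sub_add_cancel hnm]
  rw [h1, h2]
  exact Ideal.mul_mono_right h

end ArtinRees

/-! ### Growth of the lengths -/

section Growth

variable {R : Type*} [CommRing R] [IsLocalRing R] [IsNoetherianRing R]

theorem exists_growth_length_quotient_sup_pow {a b : Ideal R} {c N : ℕ}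
    (hm : a ⊔ b ≤ maximalIdeal R) (hc : maximalIdeal R ^ c ≤ a ⊔ b)
    (hN : ∀ n, N ≤ n → b ⊓ a ^ n ≤ maximalIdeal R * a ^ n) :
    ∃ (r D K : ℕ) (u : ℕ → ℕ), analyticSpread a ≤ r ∧
      (∀ n, Module.length R (R ⧸ (b ⊔ a ^ n)) = u n) ∧ (∀ n, 1 ≤ n → 1 ≤ u n) ∧
      (∀ n, 1 ≤ n → n ^ r ≤ D * u n) ∧ ∀ n, 1 ≤ n → u n ≤ K * n ^ r := by
  obtain ⟨r, D, K, hr, hD, hK⟩ := exists_growth_fiberRing a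
  obtain ⟨L, hL⟩ := ENat.ne_top_iff_exists.1
    (Module.length_ne_top_iff.2 (isFiniteLength_quotient hc))
  have hu (n : ℕ) : ∃ k : ℕ, (k : ℕ∞) = Module.length R (R ⧸ (b ⊔ a ^ n)) := by
    refine ENat.ne_top_iff_exists.1 (Module.length_ne_top_iff.2
      (isFiniteLength_quotient (c := c * n) ?_))
    rw [pow_mul]
    exact (Ideal.pow_right_mono hc n).trans (Ideal.sup_pow_le_sup_pow a b n)
  choose u hu using hu
  set μ : ℕ → ℕ := fun i => (a ^ i).spanFinrank
  have hq (n : ℕ) : ∃ q : ℕ, u (n + 1) = u n + q ∧ q ≤ μ n * L ∧ (N ≤ n → μ n ≤ q) := by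
    have hle := length_pow_quotient_comap_le a b n
    have hsucc := length_quotient_sup_pow_succ a b n
    have hge (h : N ≤ n) := spanFinrank_le_length_pow_quotient_comap (le_sup_left.trans hm) (hN n h)
    rw [← hL] at hle
    -- The upper bound shows that the increment is finite, so it can be treated as a natural number.
    obtain ⟨q, hq⟩ := ENat.ne_top_iff_exists.1 (ne_top_of_le_ne_top
      (ENat.natCast_ne_top ((a ^ n).spanFinrank * L)) (by exact_mod_cast hle))
    rw [← hq] at hle hge
    rw [← hu, ← hu, ← hq] at hsucc
    exact ⟨q, by exact_mod_cast hsucc, by exact_mod_cast hle, fun h => by exact_mod_cast hge h⟩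
  have hpos (n : ℕ) (hn : 1 ≤ n) : 1 ≤ u n := by
    have : Nontrivial (R ⧸ (b ⊔ a ^ n)) := Ideal.Quotient.nontrivial_iff.2 <|
      ne_top_of_le_ne_top (Ideal.IsPrime.ne_top' (I := maximalIdeal R)) <|
        sup_le (le_sup_right.trans hm) ((Ideal.pow_le_self (by omega)).trans (le_sup_left.trans hm))
    have := Module.length_pos (R := R) (M := R ⧸ (b ⊔ a ^ n))
    rw [← hu] at this
    exact_mod_cast this
  have hu0 : u 0 = 0 := by
    have : Subsingleton (R ⧸ (b ⊔ a ^ 0)) := Ideal.Quotient.subsingleton_iff.2 (by simp)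
    have h := hu 0
    rw [Module.length_eq_zero] at h
    exact_mod_cast h
  have hupper (n : ℕ) : u n ≤ (∑ i ∈ Finset.range n, μ i) * L := by
    induction n with
    | zero => simp [hu0]
    | succ n ih =>
      obtain ⟨q, h1, h2, -⟩ := hq n
      rw [h1, Finset.sum_range_succ, add_mul]
      exact add_le_add ih h2
  have hlower (n : ℕ) :
      ∑ i ∈ Finset.range n, μ i ≤ ∑ i ∈ Finset.range N, μ i + u n := by
    induction n with
    | zero => simp
    | succ n ih =>
      obtain ⟨q, h1, -, h3⟩ := hq n
      rcases le_or_gt N n with h | h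
      · rw [h1, Finset.sum_range_succ, ← add_assoc]
        exact add_le_add ih (h3 h)
      · exact (Finset.sum_le_sum_of_subset (Finset.range_mono h)).trans (Nat.le_add_right _ _)
  set S := ∑ i ∈ Finset.range N, μ i
  refine ⟨r, D * (S + 1), K * L, u, hr, fun n => (hu n).symm, hpos, fun n hn => ?_, fun n hn => ?_⟩
  · obtain ⟨n, rfl⟩ := Nat.exists_eq_add_of_le' hn
    -- The finitely many increments below `N`, which have no lower bound, cost the additive constant
    -- `S`; as `u (n + 1)` is at least 1, it is absorbed into the factor `S + 1`.
    have h1 : S ≤ S * u (n + 1) := Nat.le_mul_of_pos_right _ (hpos _ hn)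
    calc (n + 1) ^ r ≤ D * ∑ i ∈ Finset.range (n + 1), μ i := hD n
      _ ≤ D * ((S + 1) * u (n + 1)) := Nat.mul_le_mul_left _ <| (hlower _).trans <| by
          rw [add_mul, one_mul]; exact Nat.add_le_add_right h1 _
      _ = _ := (mul_assoc _ _ _).symm
  · obtain ⟨n, rfl⟩ := Nat.exists_eq_add_of_le' hn
    calc u (n + 1) ≤ (∑ i ∈ Finset.range (n + 1), μ i) * L := hupper _
      _ ≤ K * (n + 1) ^ r * L := Nat.mul_le_mul_right _ (hK n)
      _ = _ := mul_right_comm _ _ _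

end Growth

/-! ### The lifting system -/

section LiftingSystem

variable {R : Type*} [CommRing R]

/-- The isomorphism `R ⧸ (b + a ^ 1) ≃ (R ⧸ a) ⧸ b (R ⧸ a)`. -/
noncomputable def quotientSupPowOneEquiv (a b : Ideal R) :
    (R ⧸ (b ⊔ a ^ 1)) ≃ₗ[R] (R ⧸ a) ⧸ b.map (Ideal.Quotient.mk a) :=
  (Submodule.quotEquivOfEq _ _ (by rw [pow_one, sup_comm])).trans
    (DoubleQuot.quotQuotEquivQuotSupₐ R a b).symm.toLinearEquiv

/-- The isomorphism between `R ⧸ (b + a ^ (n + 1))` modulo `a ^ n` and `R ⧸ (b + a ^ n)`. -/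
noncomputable def quotientSupPowSuccEquiv (a b : Ideal R) (n : ℕ) :
    ((R ⧸ (b ⊔ a ^ (n + 1))) ⧸ (a ^ n • (⊤ : Submodule R (R ⧸ (b ⊔ a ^ (n + 1)))))) ≃ₗ[R]
      R ⧸ (b ⊔ a ^ n) :=
  (Submodule.quotEquivOfEq _ _ (by
    have h : Submodule.map (Submodule.mkQ (b ⊔ a ^ (n + 1))) (a ^ n) = a ^ n • ⊤ := by
      rw [← Submodule.range_mkQ (b ⊔ a ^ (n + 1)), ← Submodule.map_top, ← Submodule.map_smul'',
        smul_eq_mul, Ideal.mul_top]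
    have hb : Submodule.map (Submodule.mkQ (b ⊔ a ^ (n + 1))) b = ⊥ := by
      rw [eq_bot_iff, Submodule.map_le_iff_le_comap, Submodule.comap_bot, Submodule.ker_mkQ]
      exact le_sup_left
    rw [Submodule.map_sup, h, hb, bot_sup_eq])).trans
    (Submodule.quotientQuotientEquivQuotient (b ⊔ a ^ (n + 1)) (b ⊔ a ^ n)
      (sup_le_sup_left (Ideal.pow_le_pow_right n.le_succ) b))

theorem isLiftingSystem_quotient_sup_pow {a b : Ideal R}
    (h : ∀ n, IsFiniteLength R (R ⧸ (b ⊔ a ^ n))) :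
    IsLiftingSystem a ((R ⧸ a) ⧸ b.map (Ideal.Quotient.mk a)) (fun n => R ⧸ (b ⊔ a ^ n)) where
  finiteLength_base := by
    -- Length over `R ⧸ a` equals length over `R`, so the case n = 1 suffices.
    rw [← Module.length_ne_top_iff, ← Module.length_eq_of_surjective (S := R) (R := R ⧸ a)
      Ideal.Quotient.mk_surjective, ← (quotientSupPowOneEquiv a b).length_eq,
      Module.length_ne_top_iff]
    exact h 1
  finiteLength n _ := h n
  one := ⟨quotientSupPowOneEquiv a b⟩
  pow_le_annihilator n _ := by
    rw [Ideal.annihilator_quotient]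
    exact le_sup_right
  succ n _ := ⟨quotientSupPowSuccEquiv a b n⟩

end LiftingSystem

theorem mainTheorem6 {R : Type u} [CommRing R] [IsLocalRing R] [IsNoetherianRing R]
    (a b : Ideal R) [IsAdicComplete a R]
    (hab : (a ⊔ b).radical = maximalIdeal R)
    (hb : ∃ n, artinReesNumber a b ≤ n ∧ b ⊓ a ^ n ≤ maximalIdeal R * a ^ n) :
    IsLiftingSystem a ((R ⧸ a) ⧸ b.map (Ideal.Quotient.mk a)) (fun n => R ⧸ (b ⊔ a ^ n)) ∧
    (∃ d : ℕ, analyticSpread a ≤ (d : WithBot ℕ∞) ∧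
      GrowsLikePow (fun n => Module.length R (R ⧸ (b ⊔ a ^ n))) d) ∧
    analyticSpread a ≤ ringKrullDim (R ⧸ b) := by
  obtain ⟨N, hs, hN⟩ := hb
  obtain ⟨c, hc⟩ := Ideal.exists_radical_pow_le_of_fg (a ⊔ b) (IsNoetherian.noetherian _)
  rw [hab] at hc
  have hm : a ⊔ b ≤ maximalIdeal R := hab ▸ Ideal.le_radical
  have hbtop : b ≠ ⊤ := ne_top_of_le_ne_top (Ideal.IsPrime.ne_top' (I := maximalIdeal R))
    (le_sup_right.trans hm)
  obtain ⟨r, D, K, u, hr, hlen, hpos, hD, hK⟩ :=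
    exists_growth_length_quotient_sup_pow hm hc fun n hn => inf_pow_le_mul_of_le hs hN hn
  obtain ⟨δ, C, hδ, hC⟩ := exists_length_quotient_sup_pow_le hc hbtop
  -- The lengths are at least `n ^ r / D` and at most `C * n ^ δ`.
  have hrδ : r ≤ δ := Nat.le_of_forall_pow_le_mul_pow (C := D * C) fun n hn => by
    have h := hC n
    rw [hlen] at h
    rw [mul_assoc]
    exact (hD n hn).trans (Nat.mul_le_mul_left _ (by exact_mod_cast h))
  refine ⟨isLiftingSystem_quotient_sup_pow fun n => ?_, ⟨r, hr, .of_pow_bounds hlen hpos hD hK⟩,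
    hr.trans (le_trans (by exact_mod_cast hrδ) hδ)⟩
  rw [← Module.length_ne_top_iff, hlen]
  exact ENat.natCast_ne_top _
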